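/- Let $A$ be an $N\times N$ matrix and $B$ an $M\times M$ matrix, both with entries in $\{0,1\}$. Assume that $A$ and $B$ are irreducible (for all $i,j$ there is $k\ge 1$ with $A^k(i,j)>0$, and similarly for $B$) and satisfy condition (I) of Cuntz and Krieger: from every letter $i$ (element of the index set of the matrix) there is an admissible word (possibly of length one) leading to a letter $j$ for which there are at least two different admissible words that begin and end with $j$, have length at least two, and do not contain $j$ in between. Here a word is admissible for $A$ if $A(a,b)=1$ for any two successive letters $a,b$ of it. Let $X_A=\{(x_n)_{n\in\mathbb N}\in\{1,\dots,N\}^{\mathbb N} : A(x_n,x_{n+1})=1 \text{ for all } n\}$ with the topology induced by the product topology, let $\sigma_A((x_n)_n)=(x_{n+1})_n$, and let the continuous full group $\Gamma_A$ be the group of all homeomorphisms $\tau$ of $X_A$ for which there are continuous functions $k,l:X_A\to\mathbb Z_{\ge 0}$ with $\sigma_A^{k(x)}(\tau(x))=\sigma_A^{l(x)}(x)$ for all $x\in X_A$. Define $X_B$, $\sigma_B$, $\Gamma_B$ in the same way. Then every isomorphism of abstract groups $\alpha:\Gamma_A\to\Gamma_B$ is spatial: there is a homeomorphism $h:X_A\to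 X_B$ such that $\alpha(\gamma)=h\circ\gamma\circ h^{-1}$ for all $\gamma\in\Gamma_A$. Consequently $\Gamma_A$ and $\Gamma_B$ are isomorphic as abstract groups if and only if they are spatially isomorphic, that is, if and only if there is a homeomorphism $h:X_A\to X_B$ with $h\circ\Gamma_A\circ h^{-1}=\Gamma_B$. -/

import Mathlib

/-- The shift space `X_A` of right-infinite sequences over `{0, …, N - 1}` whose successive letters
are allowed by `A`. Its topology is the one induced from the product of discrete spaces. -/
def shiftSpace {N : ℕ} (A : Matrix (Fin N) (Fin N) ℤ) : Set (ℕ → Fin N) :=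
  {x | ∀ n, A (x n) (x (n + 1)) = 1}

/-- The shift transformation `σ_A` on `X_A`. -/
def shiftMap {N : ℕ} (A : Matrix (Fin N) (Fin N) ℤ) (x : shiftSpace A) : shiftSpace A :=
  ⟨fun n => x.1 (n + 1), fun n => x.2 (n + 1)⟩

/-- `(i, w, i)` is an admissible word that returns to the letter `i` for the first time at its
last letter. -/
def IsFirstReturn {N : ℕ} (A : Matrix (Fin N) (Fin N) ℤ) (i : Fin N) (w : List (Fin N)) : Prop :=
  i ∉ w ∧ List.IsChain (fun a b => A a b = 1) (i :: (w ++ [i]))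

/-- Condition (I) of Cuntz and Krieger: from every letter there is an admissible word to a letter
`j` that has at least two different first-return words. -/
def ConditionI {N : ℕ} (A : Matrix (Fin N) (Fin N) ℤ) : Prop :=
  ∀ i, ∃ j, Relation.ReflTransGen (fun a b => A a b = 1) i j ∧
    ∃ v w, v ≠ w ∧ IsFirstReturn A j v ∧ IsFirstReturn A j w

/-- The continuous full group `Γ_A`: the homeomorphisms `τ` of `X_A` that have continuous orbit
cocycles `k, l : X_A → ℕ`, that is, `σ_A ^ k(x) (τ x) = σ_A ^ l(x) (x)` for all `x`. -/
def continuousFullGroup {N : ℕ} (A : Matrix (Fin N) (Fin N) ℤ) :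
    Subgroup (shiftSpace A ≃ₜ shiftSpace A) where
  carrier := {τ | ∃ k l : shiftSpace A → ℕ, Continuous k ∧ Continuous l ∧
    ∀ x, (shiftMap A)^[k x] (τ x) = (shiftMap A)^[l x] x}
  mul_mem' := by
    rintro τ₁ τ₂ ⟨k₁, l₁, hk₁, hl₁, h₁⟩ ⟨k₂, l₂, hk₂, hl₂, h₂⟩
    refine ⟨fun x => k₂ x + k₁ (τ₂ x), fun x => l₁ (τ₂ x) + l₂ x,
      hk₂.add (hk₁.comp τ₂.continuous), (hl₁.comp τ₂.continuous).add hl₂, fun x => ?_⟩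
    change (shiftMap A)^[k₂ x + k₁ (τ₂ x)] (τ₁ (τ₂ x)) = _
    rw [Function.iterate_add_apply, h₁, ← Function.iterate_add_apply, add_comm,
      Function.iterate_add_apply, h₂, ← Function.iterate_add_apply]
  one_mem' := ⟨fun _ => 0, fun _ => 0, continuous_const, continuous_const, fun _ => rfl⟩
  inv_mem' := by
    rintro τ ⟨k, l, hk, hl, h⟩
    refine ⟨fun x => l (τ.symm x), fun x => k (τ.symm x), hl.comp τ.symm.continuous,
      hk.comp τ.symm.continuous, fun x => ?_⟩
    have := h (τ.symm x)
    rw [τ.apply_symm_apply] at this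
    exact this.symm

/-- A group isomorphism `α : Γ_A → Γ_B` is spatial if it has the form `γ ↦ h ∘ γ ∘ h⁻¹` for some
homeomorphism `h : X_A → X_B`. -/
def IsSpatial {N M : ℕ} {A : Matrix (Fin N) (Fin N) ℤ} {B : Matrix (Fin M) (Fin M) ℤ}
    (α : continuousFullGroup A ≃* continuousFullGroup B) : Prop :=
  ∃ h : shiftSpace A ≃ₜ shiftSpace B, ∀ γ : continuousFullGroup A,
    (α γ : shiftSpace B ≃ₜ shiftSpace B) = (h.symm.trans γ.1).trans h

/-- `Γ_A` and `Γ_B` are spatially isomorphic if `h ∘ Γ_A ∘ h⁻¹ = Γ_B` for some homeomorphism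
`h : X_A → X_B`. -/
def SpatiallyIsomorphic {N M : ℕ} (A : Matrix (Fin N) (Fin N) ℤ) (B : Matrix (Fin M) (Fin M) ℤ) :
    Prop :=
  ∃ h : shiftSpace A ≃ₜ shiftSpace B,
    (fun γ : shiftSpace A ≃ₜ shiftSpace A => (h.symm.trans γ).trans h) ''
      (continuousFullGroup A : Set (shiftSpace A ≃ₜ shiftSpace A)) =
      (continuousFullGroup B : Set (shiftSpace B ≃ₜ shiftSpace B))

/-!
The group `Γ_A` determines the space `X_A` by a reconstruction theorem in the style of Rubin. It
needs only two facts about the action of `Γ_A` on the compact Hausdorff space `X_A`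
(`HasLocalInvolutions`): every point is moved by involutions of arbitrarily small support, and the
fixed set of an involution is open.

*The two facts.* By irreducibility and condition (I), every initial part of `x` extends to a word
that leaves `x` at some position `p` and ends in the letter `x p`; exchanging that word with
`x 0, …, x p` is an involution that moves `x` (`exists_word_leaving`, `exchangeHomeomorph`). If an
involution with orbit cocycles `k, l` fixes `x`, then it fixes all points near `x` when
`k x = l x`, and otherwise the points near `x` have a common preperiod and period, so that `x` is
isolated (`isOpen_fixed_of_mul_self_eq_one`).

*Reconstruction.* The algebraic disjointness relation `AlgDisjoint` of Belk, Elliott and Matucci is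
formulated in the abstract group. Elements with disjoint supports satisfy it
(`HasLocalInvolutions.algDisjoint_of_fixed_or`), and if `f` is algebraically disjoint from `g`, then
the supports of `f` and `g ^ 12` are disjoint (`HasLocalInvolutions.pow_smul_eq_of_algDisjoint`).
Hence inclusion and disjointness of the supports of involutions, which are clopen, are properties of
the abstract group (`HasLocalInvolutions.algSubordinate_iff`,
`HasLocalInvolutions.forall_fixed_or_iff`). Under an isomorphism `α`, the point `x` is sent to the
only point `y` such that an involution `t` moves `x` exactly when `α t` moves `y`: it exists by
compactness, and this description makes the map a homeomorphism that intertwines the two actions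
(`HasLocalInvolutions.exists_homeomorph`).
-/

open scoped commutatorElement

/-! ### Disjoint supports in the language of groups -/

/-- The algebraic disjointness relation of Rubin's theorem, in the form of Belk, Elliott and Matucci.
If the supports of `f` and `g` are disjoint, then `f` is algebraically disjoint from `g`; if `f` is
algebraically disjoint from `g`, then the supports of `f` and `g ^ 12` are disjoint. -/
def AlgDisjoint {G : Type*} [Group G] (f g : G) : Prop :=
  ∀ h, ¬ Commute f h → ∃ f₁ f₂, Commute f₁ g ∧ Commute f₂ g ∧
    ⁅f₁, ⁅f₂, h⁆⁆ ≠ 1 ∧ Commute ⁅f₁, ⁅f₂, h⁆⁆ g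

/-- The group-theoretic form of "the support of `k` is contained in the support of `f`". It has this
meaning when the support of `f` is clopen. -/
def AlgSubordinate {G : Type*} [Group G] (k f : G) : Prop :=
  ∀ g, AlgDisjoint f g → Commute k (g ^ 12)

section Transport

variable {G H : Type*} [Group G] [Group H] (α : G ≃* H)

theorem algDisjoint_map_iff {f g : G} : AlgDisjoint (α f) (α g) ↔ AlgDisjoint f g := by
  simp only [AlgDisjoint, α.surjective.forall, α.surjective.exists, ← map_commutatorElement,
    commute_map_iff α.injective, ne_eq, EmbeddingLike.map_eq_one_iff]

theorem algSubordinate_map_iff {f g : G} :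
    AlgSubordinate (α f) (α g) ↔ AlgSubordinate f g := by
  simp only [AlgSubordinate, α.surjective.forall, ← map_pow,
    commute_map_iff α.injective, algDisjoint_map_iff]

end Transport

section Supports

variable {G X : Type*} [Group G] [MulAction G X]

theorem smul_mem_of_fixes_compl {U : Set X} {g : G} (hg : ∀ y ∉ U, g • y = y) {y : X}
    (hy : y ∈ U) : g • y ∈ U := by
  by_contra h
  have := hg _ h
  rw [smul_left_cancel_iff] at this
  exact h (this.symm ▸ hy)

theorem inv_smul_eq_of_fixes_compl {U : Set X} {g : G} (hg : ∀ y ∉ U, g • y = y) :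
    ∀ y ∉ U, g⁻¹ • y = y :=
  fun y hy => inv_smul_eq_iff.2 (hg y hy).symm

theorem commute_of_forall_fixed_or [FaithfulSMul G X] {f g : G}
    (h : ∀ x : X, f • x = x ∨ g • x = x) : Commute f g := by
  refine FaithfulSMul.eq_of_smul_eq_smul (α := X) fun x => ?_
  rw [mul_smul, mul_smul]
  rcases h x with hf | hg
  · rcases h (g • x) with hf' | hg'
    · rw [hf, hf']
    · rw [smul_left_cancel_iff] at hg'
      rw [hf, hg', hf]
  · rcases h (f • x) with hf' | hg'
    · rw [smul_left_cancel_iff] at hf'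
      rw [hg, hf', hg]
    · rw [hg, hg']

/-- A Hausdorff space separates a point from its image by a neighbourhood of the point. -/
theorem exists_open_disjoint_smul [TopologicalSpace X] [T2Space X] [ContinuousConstSMul G X]
    {g : G} {x : X} (h : g • x ≠ x) : ∃ U : Set X, IsOpen U ∧ x ∈ U ∧ ∀ y ∈ U, g • y ∉ U := by
  obtain ⟨V, W, hV, hW, hxV, hxW, hd⟩ := t2_separation h
  refine ⟨W ∩ (g • ·) ⁻¹' V, hW.inter (hV.preimage (continuous_const_smul g)), ⟨hxW, hxV⟩,
    fun y hy hgy => ?_⟩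
  exact Set.disjoint_left.1 hd hy.2 hgy.1

end Supports

/-! ### Actions with many involutions -/

/-- The dynamical input of the reconstruction theorem: every point is moved by involutions of
arbitrarily small support, and the support of an involution is closed (it is always open). -/
structure HasLocalInvolutions (G X : Type*) [Group G] [TopologicalSpace X] [MulAction G X] :
    Prop where
  exists_moving : ∀ (x : X) (U : Set X), IsOpen U → x ∈ U →
    ∃ t : G, t * t = 1 ∧ t • x ≠ x ∧ ∀ y ∉ U, t • y = y
  isOpen_fixed : ∀ t : G, t * t = 1 → IsOpen {x : X | t • x = x}

namespace HasLocalInvolutions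

variable {G X : Type*} [Group G] [TopologicalSpace X] [T2Space X] [MulAction G X]
  [ContinuousConstSMul G X] [FaithfulSMul G X]

theorem algDisjoint_of_fixed_or (hG : HasLocalInvolutions G X) {f g : G}
    (hfg : ∀ x : X, f • x = x ∨ g • x = x) : AlgDisjoint f g := by
  intro h hfh
  obtain ⟨x, hfx, hhx⟩ : ∃ x : X, f • x ≠ x ∧ h • x ≠ x := by
    by_contra! hcon
    exact hfh (commute_of_forall_fixed_or fun x => or_iff_not_imp_left.2 (hcon x))
  obtain ⟨U₀, hU₀, hxU₀, hU₀h⟩ := exists_open_disjoint_smul hhx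
  have hopen : IsOpen {y : X | f • y ≠ y} :=
    isOpen_ne_fun (continuous_const_smul f) continuous_id
  set U := U₀ ∩ {y : X | f • y ≠ y} with hU
  obtain ⟨f₂, -, hf₂x, hf₂⟩ := hG.exists_moving x U (hU₀.inter hopen) ⟨hxU₀, hfx⟩
  obtain ⟨V, hV, hxV, hVf₂⟩ := exists_open_disjoint_smul hf₂x
  obtain ⟨f₁, -, hf₁x, hf₁⟩ := hG.exists_moving x (U ∩ V) ((hU₀.inter hopen).inter hV)
    ⟨⟨hxU₀, hfx⟩, hxV⟩
  have hf₁U : ∀ y ∉ U, f₁ • y = y := fun y hy => hf₁ y fun h => hy h.1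
  have comm : ∀ a : G, (∀ y ∉ U, a • y = y) → Commute a g := fun a ha =>
    commute_of_forall_fixed_or fun y => by
      by_cases hy : y ∈ U
      · exact .inr ((hfg y).resolve_left hy.2)
      · exact .inl (ha y hy)
  -- On `U` the commutator `⁅f₂, h⁆` acts as `f₂`.
  have hk : ∀ y ∈ U, ⁅f₂, h⁆ • y = f₂ • y := by
    intro y hy
    have h1 : h⁻¹ • y ∉ U := fun hmem => hU₀h _ hmem.1 (by simpa using hy.1)
    rw [commutatorElement_def, mul_smul, mul_smul, mul_smul,
      inv_smul_eq_of_fixes_compl hf₂ _ h1, smul_inv_smul]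
  have hkU : ∀ y ∉ U, ⁅f₂, h⁆⁻¹ • y ∉ U := by
    intro y hy hmem
    have := hk _ hmem
    rw [smul_inv_smul] at this
    exact hy (this ▸ smul_mem_of_fixes_compl hf₂ hmem)
  refine ⟨f₁, f₂, comm _ hf₁U, comm _ hf₂, fun hone => ?_, comm _ fun y hy => ?_⟩
  · have hc := congrArg (· • x) (commutatorElement_eq_one_iff_mul_comm.1 hone)
    simp only [mul_smul] at hc
    rw [hk x ⟨hxU₀, hfx⟩, hk _ (smul_mem_of_fixes_compl hf₁U ⟨hxU₀, hfx⟩),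
      hf₁ _ fun hmem => hVf₂ x hxV hmem.2, smul_left_cancel_iff] at hc
    exact hf₁x hc.symm
  · rw [commutatorElement_def f₁, mul_smul, mul_smul, mul_smul,
      inv_smul_eq_of_fixes_compl hf₁U _ (hkU y hy), smul_inv_smul, hf₁U y hy]

/-- If `g ^ 12` moved a point `x` moved by `f`, then `x, g x, …, g⁴ x` would be distinct, because
`1, 2, 3, 4` divide `12`. For `h` supported in a small neighbourhood `U` of `x`, the commutator
`c = ⁅f₁, ⁅f₂, h⁆⁆` is supported in the four translates of `U` by `1, f₁, f₂, f₁ f₂`. All of these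
and `c` commute with `g`, so a point moved by `c` has five `g`-translates in the four sets. -/
theorem pow_smul_eq_of_algDisjoint (hG : HasLocalInvolutions G X) {f g : G}
    (hfg : AlgDisjoint f g) {x : X} (hfx : f • x ≠ x) : g ^ 12 • x = x := by
  by_contra hgx
  have hne : ∀ n m : ℕ, n * m = 12 → g ^ n • x ≠ x := by
    intro n m hnm hn
    apply hgx
    rw [← hnm, pow_mul]
    exact MulAction.mem_fixedBy.1 (by
      simpa using MulAction.mem_fixedBy_zpow (g := g ^ n) (a := x) hn m)
  obtain ⟨U₀, hU₀, hx₀, h₀⟩ := exists_open_disjoint_smul hfx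
  obtain ⟨U₁, hU₁, hx₁, h₁⟩ := exists_open_disjoint_smul (hne 1 12 rfl)
  obtain ⟨U₂, hU₂, hx₂, h₂⟩ := exists_open_disjoint_smul (hne 2 6 rfl)
  obtain ⟨U₃, hU₃, hx₃, h₃⟩ := exists_open_disjoint_smul (hne 3 4 rfl)
  obtain ⟨U₄, hU₄, hx₄, h₄⟩ := exists_open_disjoint_smul (hne 4 3 rfl)
  set U := U₀ ∩ (U₁ ∩ (U₂ ∩ (U₃ ∩ U₄))) with hU
  have hUg : ∀ n : ℕ, 1 ≤ n → n ≤ 4 → ∀ y ∈ U, g ^ n • y ∉ U := by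
    rintro n hn1 hn4 y ⟨-, hy₁, hy₂, hy₃, hy₄⟩ ⟨-, hz₁, hz₂, hz₃, hz₄⟩
    interval_cases n
    exacts [h₁ y hy₁ hz₁, h₂ y hy₂ hz₂, h₃ y hy₃ hz₃, h₄ y hy₄ hz₄]
  obtain ⟨h, -, hhx, hh⟩ := hG.exists_moving x U
    (hU₀.inter (hU₁.inter (hU₂.inter (hU₃.inter hU₄)))) ⟨hx₀, hx₁, hx₂, hx₃, hx₄⟩
  have hfh : ¬ Commute f h := by
    intro hc
    have := congrArg (· • x) hc.eq
    simp only [mul_smul] at this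
    rw [hh (f • x) fun hmem => h₀ x hx₀ hmem.1, smul_left_cancel_iff] at this
    exact hhx this
  obtain ⟨f₁, f₂, hf₁, hf₂, hc1, hcg⟩ := hfg h hfh
  obtain ⟨y, hy⟩ : ∃ y : X, ⁅f₁, ⁅f₂, h⁆⁆ • y ≠ y := by
    by_contra! hcon
    exact hc1 (FaithfulSMul.eq_of_smul_eq_smul (α := X) fun z => by rw [hcon z, one_smul])
  have hk : ∀ z : X, z ∉ U → f₂⁻¹ • z ∉ U → ⁅f₂, h⁆ • z = z := by
    intro z hz hz'
    rw [commutatorElement_def, mul_smul, mul_smul, mul_smul, inv_smul_eq_of_fixes_compl hh _ hz,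
      hh _ hz', smul_inv_smul]
  let F : Fin 4 → G := ![1, f₁, f₂, f₁ * f₂]
  have hF : ∀ a, Commute (F a) g := by
    intro a
    fin_cases a
    exacts [Commute.one_left g, hf₁, hf₂, hf₁.mul_left hf₂]
  have hcover : ∀ z : X, ⁅f₁, ⁅f₂, h⁆⁆ • z ≠ z → ∃ a, (F a)⁻¹ • z ∈ U := by
    intro z hz
    by_contra! hcon
    have c0 : z ∉ U := by simpa [F] using hcon 0
    have c1 : f₁⁻¹ • z ∉ U := by simpa [F] using hcon 1
    have c2 : f₂⁻¹ • z ∉ U := by simpa [F] using hcon 2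
    have c3 : f₂⁻¹ • f₁⁻¹ • z ∉ U := by simpa [F, mul_smul] using hcon 3
    apply hz
    rw [commutatorElement_def f₁, mul_smul, mul_smul, mul_smul,
      inv_smul_eq_iff.2 (hk z c0 c2).symm, hk _ c1 c3, smul_inv_smul]
  have hmoved : ∀ i : Fin 5, ⁅f₁, ⁅f₂, h⁆⁆ • g ^ (i : ℕ) • y ≠ g ^ (i : ℕ) • y := by
    intro i hi
    rw [← mul_smul, (hcg.pow_right i).eq, mul_smul, smul_left_cancel_iff] at hi
    exact hy hi
  choose a ha using fun i : Fin 5 => hcover _ (hmoved i)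
  obtain ⟨i, j, hij, haij⟩ := Fintype.exists_ne_map_eq_of_card_lt a (by simp)
  have key : ∀ i j : Fin 5, i < j → a i = a j → False := by
    intro i j hlt haij
    refine hUg (j - i : ℕ) (by omega) (by omega) _ (ha i) ?_
    have hcomm : Commute (g ^ (j - i : ℕ)) (F (a i))⁻¹ := ((hF _).symm.pow_left _).inv_right
    rw [← mul_smul, hcomm.eq, mul_smul, ← mul_smul (g ^ _), ← pow_add,
      Nat.sub_add_cancel (le_of_lt hlt), haij]
    exact ha j
  rcases lt_or_gt_of_ne hij with hlt | hlt
  · exact key i j hlt haij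
  · exact key j i hlt haij.symm

/-- There are elements of order `2 ^ (n + 1)` with arbitrarily small support: if `g` lives on a set
`V` that is disjoint from its image under the involution `t`, then `(t g)²` is `g` on `V` and a
conjugate of `g` on `t V`, so that `t g` has twice the order of `g`. -/
theorem exists_two_pow (hG : HasLocalInvolutions G X) (n : ℕ) (x : X) (U : Set X)
    (hU : IsOpen U) (hx : x ∈ U) :
    ∃ g : G, g ^ 2 ^ (n + 1) = 1 ∧ g ^ 2 ^ n • x ≠ x ∧ ∀ y ∉ U, g • y = y := by
  induction n generalizing U with
  | zero =>
    obtain ⟨t, ht, htx, htU⟩ := hG.exists_moving x U hU hx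
    exact ⟨t, by simpa [pow_two] using ht, by simpa using htx, htU⟩
  | succ n ih =>
    obtain ⟨t, ht, htx, htU⟩ := hG.exists_moving x U hU hx
    obtain ⟨V, hV, hxV, hVt⟩ := exists_open_disjoint_smul htx
    obtain ⟨g, hg1, hgx, hgV⟩ := ih (U ∩ V) (hU.inter hV) ⟨hx, hxV⟩
    have htinv : t⁻¹ = t := inv_eq_of_mul_eq_one_left ht
    have htt : ∀ y : X, t • t • y = y := fun y => by rw [← mul_smul, ht, one_smul]
    have hcomm : Commute (t * g * t⁻¹) g := commute_of_forall_fixed_or (X := X) fun y => by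
      by_cases hy : y ∈ U ∩ V
      · left
        rw [htinv, mul_smul, mul_smul, hgV _ fun hmem => hVt y hy.2 hmem.2, htt]
      · exact .inr (hgV y hy)
    have hsq : ∀ m : ℕ, (t * g) ^ (2 * m) = (t * g ^ m * t⁻¹) * g ^ m := by
      intro m
      rw [← conj_pow, ← hcomm.mul_pow, pow_mul, pow_two]
      congr 1
      rw [htinv]
      group
    refine ⟨t * g, ?_, ?_, fun y hy => ?_⟩
    · rw [pow_succ', hsq, hg1]
      simp
    · have hgm : g ^ 2 ^ n • x ∈ U ∩ V := by
        have : ∀ m : ℕ, g ^ m • x ∈ U ∩ V := by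
          intro m
          induction m with
          | zero => simpa using ⟨hx, hxV⟩
          | succ m ihm =>
            rw [pow_succ', mul_smul]
            exact smul_mem_of_fixes_compl hgV ihm
        exact this _
      have hfix : ∀ m : ℕ, ∀ y ∉ U ∩ V, g ^ m • y = y := by
        intro m y hy
        simpa using MulAction.mem_fixedBy_zpow (g := g) (a := y) (hgV y hy) m
      rw [pow_succ' 2 n, hsq, mul_smul, mul_smul, mul_smul, htinv,
        hfix _ _ fun hmem => hVt _ hgm.2 hmem.2, htt]
      exact hgx
    · rw [mul_smul, hgV y fun hmem => hy hmem.1, htU y hy]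

theorem algSubordinate_iff (hG : HasLocalInvolutions G X) {k f : G}
    (hf : IsOpen {x : X | f • x = x}) :
    AlgSubordinate k f ↔ ∀ x : X, f • x = x → k • x = x := by
  constructor
  · intro hkf x hfx
    by_contra hkx
    obtain ⟨V, hV, hxV, hVk⟩ := exists_open_disjoint_smul hkx
    obtain ⟨g, hg16, hg8, hgU⟩ := hG.exists_two_pow 3 x _ (hf.inter hV) ⟨hfx, hxV⟩
    have hd : AlgDisjoint f g := hG.algDisjoint_of_fixed_or fun y => by
      by_cases hy : f • y = y
      · exact .inl hy
      · exact .inr (hgU y fun hmem => hy hmem.1)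
    have h12 : g ^ 12 • x = x := by
      have := congrArg (· • x) (hkf g hd).eq
      simp only [mul_smul] at this
      have hfix : g ^ 12 • k • x = k • x := by
        simpa using MulAction.mem_fixedBy_zpow (g := g) (a := k • x)
          (hgU _ fun hmem => hVk x hxV hmem.2) 12
      rwa [hfix, smul_left_cancel_iff] at this
    -- `g` has order `16` and `24 ≡ 8` modulo `16`.
    apply hg8
    have h24 : g ^ 2 ^ 3 = g ^ 12 * g ^ 12 := by
      rw [← pow_add, show 12 + 12 = 2 ^ 3 + 2 ^ (3 + 1) by norm_num, pow_add, hg16, mul_one]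
    rw [h24, mul_smul, h12, h12]
  · intro hkf g hd
    refine commute_of_forall_fixed_or (X := X) fun y => ?_
    by_cases hy : f • y = y
    · exact .inl (hkf y hy)
    · exact .inr (hG.pow_smul_eq_of_algDisjoint hd hy)

/-- Disjointness of clopen supports in terms of inclusion of supports: no nontrivial element is
supported in both. -/
theorem forall_fixed_or_iff (hG : HasLocalInvolutions G X) {s t : G}
    (hs : IsOpen {x : X | s • x = x}) (ht : IsOpen {x : X | t • x = x}) :
    (∀ x : X, s • x = x ∨ t • x = x) ↔
      ∀ m : G, AlgSubordinate m s → AlgSubordinate m t → m = 1 := by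
  simp only [hG.algSubordinate_iff hs, hG.algSubordinate_iff ht]
  constructor
  · intro h m hms hmt
    exact FaithfulSMul.eq_of_smul_eq_smul (α := X) fun x => by
      rw [one_smul]
      exact (h x).elim (hms x) (hmt x)
  · intro h x
    by_contra! hx
    obtain ⟨m, -, hmx, hm⟩ := hG.exists_moving x ({x | s • x ≠ x} ∩ {x | t • x ≠ x})
      ((isOpen_ne_fun (continuous_const_smul s) continuous_id).inter
        (isOpen_ne_fun (continuous_const_smul t) continuous_id)) hx
    have hm1 := h m (fun y hy => hm y fun hmem => hmem.1 hy) fun y hy => hm y fun hmem => hmem.2 hy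
    exact hmx (by rw [hm1, one_smul])

end HasLocalInvolutions

/-! ### Reconstruction of the space -/

section Corresponds

variable {G H X Y : Type*} [Group G] [Group H] [MulAction G X] [MulAction H Y] {α : G ≃* H}

/-- The points `x` and `y` correspond under `α` if `α` matches the involutions that move `x` with
those that move `y`. -/
def Corresponds (α : G ≃* H) (x : X) (y : Y) : Prop :=
  ∀ t : G, t * t = 1 → (t • x ≠ x ↔ α t • y ≠ y)

theorem Corresponds.symm {x : X} {y : Y} (h : Corresponds α x y) :
    Corresponds α.symm y x := by
  intro s hs
  have := h (α.symm s) (by rw [← map_mul, hs, map_one])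
  rw [α.apply_symm_apply] at this
  exact this.symm

theorem Corresponds.smul {x : X} {y : Y} (h : Corresponds α x y) (g : G) :
    Corresponds α (g • x) (α g • y) := by
  intro t ht
  have := h (g⁻¹ * t * g) (by
    rw [show g⁻¹ * t * g * (g⁻¹ * t * g) = g⁻¹ * (t * t) * g by group, ht]
    group)
  simpa [mul_smul, inv_smul_eq_iff] using this

variable [TopologicalSpace Y]

theorem Corresponds.unique [T1Space Y] (hH : HasLocalInvolutions H Y) {x : X} {y z : Y}
    (hy : Corresponds α x y) (hz : Corresponds α x z) : y = z := by
  by_contra hne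
  obtain ⟨s, hs, hsy, hsU⟩ := hH.exists_moving y {z}ᶜ isOpen_compl_singleton hne
  have hs' : α.symm s * α.symm s = 1 := by rw [← map_mul, hs, map_one]
  have := (hz _ hs').1 ((hy _ hs').2 (by simpa using hsy))
  rw [α.apply_symm_apply] at this
  exact this (hsU z (by simp))

variable [TopologicalSpace X] [T2Space X] [ContinuousConstSMul G X]

theorem continuous_of_corresponds (hH : HasLocalInvolutions H Y) {h : X → Y}
    (hh : ∀ x, Corresponds α x (h x)) : Continuous h := by
  rw [continuous_iff_continuousAt]
  intro x U hU
  obtain ⟨V, hVU, hV, hxV⟩ := mem_nhds_iff.1 hU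
  obtain ⟨s, hs, hsx, hsV⟩ := hH.exists_moving (h x) V hV hxV
  have hs' : α.symm s * α.symm s = 1 := by rw [← map_mul, hs, map_one]
  have hiff : ∀ z, α.symm s • z ≠ z ↔ s • h z ≠ h z := fun z => by
    simpa using hh z (α.symm s) hs'
  rw [Filter.mem_map]
  refine Filter.mem_of_superset ((isOpen_ne_fun (continuous_const_smul (α.symm s))
    continuous_id).mem_nhds ((hiff x).2 hsx)) fun z hz => hVU ?_
  by_contra hzV
  exact (hiff z).1 hz (hsV _ hzV)

end Corresponds

namespace HasLocalInvolutions

variable {G X : Type*} [Group G] [TopologicalSpace X] [T2Space X] [MulAction G X]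
  [ContinuousConstSMul G X] [FaithfulSMul G X]
variable {H Y : Type*} [Group H] [TopologicalSpace Y] [T2Space Y] [MulAction H Y]
  [ContinuousConstSMul H Y] [FaithfulSMul H Y]

theorem map_fixes_of_fixes (hG : HasLocalInvolutions G X) (hH : HasLocalInvolutions H Y)
    (α : G ≃* H) {s t : G} (ht : t * t = 1)
    (h : ∀ x : X, t • x = x → s • x = x) (y : Y) (hy : α t • y = y) : α s • y = y := by
  have hαt : α t * α t = 1 := by rw [← map_mul, ht, map_one]
  refine (hH.algSubordinate_iff (hH.isOpen_fixed _ hαt)).1 ?_ y hy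
  rwa [algSubordinate_map_iff, hG.algSubordinate_iff (hG.isOpen_fixed _ ht)]

theorem map_fixed_or_of_fixed_or (hG : HasLocalInvolutions G X) (hH : HasLocalInvolutions H Y)
    (α : G ≃* H) {s t : G} (hs : s * s = 1) (ht : t * t = 1)
    (h : ∀ x : X, s • x = x ∨ t • x = x) (y : Y) : α s • y = y ∨ α t • y = y := by
  have hαs : α s * α s = 1 := by rw [← map_mul, hs, map_one]
  have hαt : α t * α t = 1 := by rw [← map_mul, ht, map_one]
  refine (hH.forall_fixed_or_iff (hH.isOpen_fixed _ hαs) (hH.isOpen_fixed _ hαt)).2 ?_ y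
  simp only [α.surjective.forall, algSubordinate_map_iff, EmbeddingLike.map_eq_one_iff]
  exact (hG.forall_fixed_or_iff (hG.isOpen_fixed _ hs) (hG.isOpen_fixed _ ht)).1 h

/-- The supports of the `α t`, for `t` an involution moving `x`, form a downward directed family of
nonempty compact sets, so they have a common point. -/
theorem exists_corresponds [CompactSpace Y] (hG : HasLocalInvolutions G X)
    (hH : HasLocalInvolutions H Y) (α : G ≃* H) (x : X) : ∃ y : Y, Corresponds α x y := by
  let S : {t : G // t * t = 1 ∧ t • x ≠ x} → Set Y := fun t => {y | α t.1 • y ≠ y}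
  have : Nonempty {t : G // t * t = 1 ∧ t • x ≠ x} := by
    obtain ⟨t, ht, htx, -⟩ := hG.exists_moving x Set.univ isOpen_univ trivial
    exact ⟨⟨t, ht, htx⟩⟩
  have hmono : ∀ s t : {t : G // t * t = 1 ∧ t • x ≠ x},
      (∀ z : X, t.1 • z = z → s.1 • z = z) → S s ⊆ S t := fun s t h y hy hty =>
    hy (hG.map_fixes_of_fixes hH α t.2.1 h y hty)
  have hne (a : G) : IsOpen {z : X | a • z ≠ z} :=
    isOpen_ne_fun (continuous_const_smul a) continuous_id
  have hdir : Directed (· ⊇ ·) S := by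
    intro s t
    obtain ⟨m, hm, hmx, hmU⟩ := hG.exists_moving x ({z | s.1 • z ≠ z} ∩ {z | t.1 • z ≠ z})
      ((hne _).inter (hne _)) ⟨s.2.2, t.2.2⟩
    exact ⟨⟨m, hm, hmx⟩, hmono _ _ fun z hz => hmU z fun hmem => hmem.1 hz,
      hmono _ _ fun z hz => hmU z fun hmem => hmem.2 hz⟩
  have hclosed : ∀ t, IsClosed (S t) := fun t => by
    have := hH.isOpen_fixed (α t.1) (by rw [← map_mul, t.2.1, map_one])
    exact this.isClosed_compl
  have hnonempty : ∀ t, (S t).Nonempty := by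
    intro t
    by_contra hcon
    rw [Set.not_nonempty_iff_eq_empty, Set.eq_empty_iff_forall_notMem] at hcon
    have h1 : α t.1 = 1 := FaithfulSMul.eq_of_smul_eq_smul (α := Y) fun y => by
      rw [one_smul]
      exact not_not.1 (hcon y)
    rw [EmbeddingLike.map_eq_one_iff] at h1
    exact t.2.2 (by rw [h1, one_smul])
  obtain ⟨y, hy⟩ := IsCompact.nonempty_iInter_of_directed_nonempty_isCompact_isClosed S hdir
    hnonempty (fun t => (hclosed t).isCompact) hclosed
  rw [Set.mem_iInter] at hy
  refine ⟨y, fun t ht => ⟨fun htx => hy ⟨t, ht, htx⟩, fun hty htx => ?_⟩⟩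
  -- An involution `m` moving `x` and supported in the open fixed set of `t` separates the supports.
  obtain ⟨m, hm, hmx, hmU⟩ := hG.exists_moving x _ (hG.isOpen_fixed t ht) htx
  refine (hG.map_fixed_or_of_fixed_or hH α ht hm (fun z => ?_) y).elim hty (hy ⟨m, hm, hmx⟩)
  by_cases hz : t • z = z
  · exact .inl hz
  · exact .inr (hmU z hz)

/-- An isomorphism between groups with many involutions on compact Hausdorff spaces is induced by a
homeomorphism. -/
theorem exists_homeomorph [CompactSpace X] [CompactSpace Y] (hG : HasLocalInvolutions G X)
    (hH : HasLocalInvolutions H Y) (α : G ≃* H) :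
    ∃ h : X ≃ₜ Y, ∀ (g : G) (x : X), h (g • x) = α g • h x := by
  choose h hh using hG.exists_corresponds hH α
  choose k hk using hH.exists_corresponds hG α.symm
  refine ⟨⟨⟨h, k, fun x => ?_, fun y => ?_⟩, continuous_of_corresponds hH hh,
    continuous_of_corresponds hG hk⟩, fun g x => ?_⟩
  · exact (hk (h x)).unique hG (hh x).symm
  · exact (hh (k y)).unique hH (hk y).symm
  · exact (hh (g • x)).unique hH ((hh x).smul g)

end HasLocalInvolutions

/-! ### Words and cylinders of the shift space -/

section Words

variable {N : ℕ} {A : Matrix (Fin N) (Fin N) ℤ}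

/-- The letters `w 0, …, w q` form an admissible word. A word is the initial part of a sequence
`ℕ → Fin N`, whose later letters are irrelevant. -/
def IsWord (A : Matrix (Fin N) (Fin N) ℤ) (w : ℕ → Fin N) (q : ℕ) : Prop :=
  ∀ i < q, A (w i) (w (i + 1)) = 1

theorem IsWord.exists_snoc {w : ℕ → Fin N} {q : ℕ} (hw : IsWord A w q) {b : Fin N}
    (hb : A (w q) b = 1) :
    ∃ w', (∀ i ≤ q, w' i = w i) ∧ IsWord A w' (q + 1) ∧ w' (q + 1) = b := by
  have hle : ∀ i ≤ q, Function.update w (q + 1) b i = w i := fun i hi =>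
    Function.update_of_ne (by omega) _ _
  refine ⟨Function.update w (q + 1) b, hle, fun i hi => ?_, by simp⟩
  rcases Nat.lt_succ_iff_lt_or_eq.1 hi with h | rfl
  · rw [hle i h.le, hle (i + 1) h]
    exact hw i h
  · rwa [hle i le_rfl, Function.update_self]

theorem IsWord.exists_extension {w : ℕ → Fin N} {q : ℕ} (hw : IsWord A w q) {b : Fin N}
    (hb : Relation.ReflTransGen (fun a b => A a b = 1) (w q) b) :
    ∃ w' q', q ≤ q' ∧ (∀ i ≤ q, w' i = w i) ∧ IsWord A w' q' ∧ w' q' = b := by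
  induction hb with
  | refl => exact ⟨w, q, le_rfl, fun _ _ => rfl, hw, rfl⟩
  | tail _ hbc ih =>
    obtain ⟨w₁, q₁, hq, hw₁, hword, rfl⟩ := ih
    obtain ⟨w₂, hw₂, hword₂, hc⟩ := hword.exists_snoc hbc
    exact ⟨w₂, q₁ + 1, by omega, fun i hi => (hw₂ i (by omega)).trans (hw₁ i hi), hword₂, hc⟩

theorem reflTransGen_of_isIrreducible (h01 : ∀ i j, A i j = 0 ∨ A i j = 1)
    (hirr : A.IsIrreducible) (i j : Fin N) :
    Relation.ReflTransGen (fun a b => A a b = 1) i j := by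
  obtain ⟨p, -⟩ := hirr.connected i j
  induction p with
  | nil => exact .refl
  | cons p e ih => exact ih.tail ((h01 _ _).resolve_left e.down.ne')

/-- If every letter had at most one successor, then a first-return word would be determined by its
first letter. -/
theorem ConditionI.exists_branching (hI : ConditionI A) (i : Fin N) :
    ∃ a b c, b ≠ c ∧ A a b = 1 ∧ A a c = 1 := by
  obtain ⟨j, -, v, w, hvw, ⟨hjv, hv⟩, ⟨hjw, hw⟩⟩ := hI i
  by_contra! hdet
  have hdet' : ∀ a b c, A a b = 1 → A a c = 1 → b = c := fun a b c hb hc => by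
    by_contra hbc
    exact hdet a b c hbc hb hc
  suffices h : ∀ (v w : List (Fin N)) (a : Fin N), j ∉ v → j ∉ w →
      List.IsChain (fun a b => A a b = 1) (a :: (v ++ [j])) →
      List.IsChain (fun a b => A a b = 1) (a :: (w ++ [j])) → v = w from hvw (h v w j hjv hjw hv hw)
  intro v
  induction v with
  | nil =>
    rintro (_ | ⟨c, w⟩) a - hjw hv hw
    · rfl
    · simp only [List.nil_append, List.cons_append, List.isChain_cons_cons] at hv hw
      exact absurd (hdet' _ _ _ hv.1 hw.1) fun h => hjw (h ▸ List.mem_cons_self)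
  | cons b v ih =>
    rintro (_ | ⟨c, w⟩) a hjv hjw hv hw
    · simp only [List.nil_append, List.cons_append, List.isChain_cons_cons] at hv hw
      exact absurd (hdet' _ _ _ hw.1 hv.1) fun h => hjv (h ▸ List.mem_cons_self)
    · simp only [List.cons_append, List.isChain_cons_cons] at hv hw
      obtain rfl := hdet' _ _ _ hv.1 hw.1
      rw [ih w b (fun h => hjv (List.mem_cons_of_mem _ h)) (fun h => hjw (List.mem_cons_of_mem _ h))
        hv.2 hw.2]

/-- Every initial part of a point `x` extends to a word that leaves `x` at a position `p` and ends in
the letter `x p`. -/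
theorem exists_word_leaving (h01 : ∀ i j, A i j = 0 ∨ A i j = 1) (hirr : A.IsIrreducible)
    (hI : ConditionI A) (x : shiftSpace A) (n : ℕ) :
    ∃ w q p, n ≤ p ∧ p ≤ q ∧ (∀ i ≤ n, w i = x.1 i) ∧ w p ≠ x.1 p ∧ IsWord A w q ∧
      w q = x.1 p := by
  obtain ⟨a, b, c, hbc, hb, hc⟩ := hI.exists_branching (x.1 0)
  obtain ⟨w₁, q₁, hq₁, hw₁, hword₁, rfl⟩ :=
    IsWord.exists_extension (q := n) (fun i _ => x.2 i) (reflTransGen_of_isIrreducible h01 hirr _ a)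
  obtain ⟨d, hd, hdx⟩ : ∃ d, A (w₁ q₁) d = 1 ∧ d ≠ x.1 (q₁ + 1) := by
    by_cases h : b = x.1 (q₁ + 1)
    · exact ⟨c, hc, fun hcx => hbc (h.trans hcx.symm)⟩
    · exact ⟨b, hb, h⟩
  obtain ⟨w₂, hw₂, hword₂, rfl⟩ := hword₁.exists_snoc hd
  obtain ⟨w₃, q₃, hq₃, hw₃, hword₃, hend⟩ := hword₂.exists_extension
    (reflTransGen_of_isIrreducible h01 hirr _ (x.1 (q₁ + 1)))
  refine ⟨w₃, q₃, q₁ + 1, by omega, hq₃, fun i hi => ?_, ?_, hword₃, hend⟩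
  · rw [hw₃ i (by omega), hw₂ i (by omega), hw₁ i hi]
  · rwa [hw₃ _ le_rfl]

theorem isClopen_cylinder (u : ℕ → Fin N) (p : ℕ) :
    IsClopen {z : shiftSpace A | ∀ i ≤ p, z.1 i = u i} := by
  have h : {z : shiftSpace A | ∀ i ≤ p, z.1 i = u i} =
      ⋂ i ∈ Finset.range (p + 1), (fun z : shiftSpace A => z.1 i) ⁻¹' {u i} := by
    ext z
    simp
  rw [h]
  exact isClopen_biInter_finset fun i _ =>
    (isClopen_discrete _).preimage ((continuous_apply i).comp continuous_subtype_val)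

theorem exists_cylinder_subset {U : Set (shiftSpace A)} (hU : IsOpen U) {x : shiftSpace A}
    (hx : x ∈ U) : ∃ n, ∀ z : shiftSpace A, (∀ i ≤ n, z.1 i = x.1 i) → z ∈ U := by
  obtain ⟨V, hV, rfl⟩ := isOpen_induced_iff.1 hU
  obtain ⟨_, ⟨y, n, rfl⟩, hxy, hsub⟩ :=
    (PiNat.isTopologicalBasis_cylinders fun _ : ℕ => Fin N).exists_subset_of_mem_open hx hV
  refine ⟨n, fun z hz => hsub fun i hi => (hz i hi.le).trans (hxy i hi)⟩

theorem isCompact_shiftSpace (A : Matrix (Fin N) (Fin N) ℤ) : IsCompact (shiftSpace A) := by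
  refine IsClosed.isCompact ?_
  rw [shiftSpace, Set.ofPred_forall]
  refine isClosed_iInter fun n => ?_
  have h : Continuous fun x : ℕ → Fin N => (x n, x (n + 1)) := by fun_prop
  exact (isClosed_discrete {ab : Fin N × Fin N | A ab.1 ab.2 = 1}).preimage h

theorem shiftMap_iterate_apply (k : ℕ) (x : shiftSpace A) (i : ℕ) :
    ((shiftMap A)^[k] x).1 i = x.1 (i + k) := by
  induction k generalizing x with
  | zero => rfl
  | succ k ih => rw [Function.iterate_succ_apply, ih]; exact congrArg x.1 (by omega)

end Words

/-! ### Prefix exchanges -/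

section Exchange

variable {N : ℕ} {A : Matrix (Fin N) (Fin N) ℤ}

/-- Replace the letters `0, …, p` of `z` by the word `w 0, …, w q`. -/
def splice (w : ℕ → Fin N) (q p : ℕ) (z : ℕ → Fin N) : ℕ → Fin N :=
  fun i => if i ≤ q then w i else z (i - q + p)

theorem splice_of_le {w : ℕ → Fin N} {q p : ℕ} {z : ℕ → Fin N} {i : ℕ} (hi : i ≤ q) :
    splice w q p z i = w i := if_pos hi

theorem splice_add {w : ℕ → Fin N} {q p : ℕ} {z : ℕ → Fin N} (h : w q = z p) (i : ℕ) :
    splice w q p z (i + q) = z (i + p) := by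
  rcases Nat.eq_zero_or_pos i with rfl | hi
  · simp [splice, h]
  · rw [splice, if_neg (by omega), Nat.add_sub_cancel]

theorem splice_mem {w : ℕ → Fin N} {q p : ℕ} {z : ℕ → Fin N} (hw : IsWord A w q)
    (hz : z ∈ shiftSpace A) (h : w q = z p) : splice w q p z ∈ shiftSpace A := by
  intro i
  rcases lt_or_ge i q with hi | hi
  · rw [splice_of_le hi.le, splice_of_le hi]
    exact hw i hi
  · obtain ⟨j, rfl⟩ := Nat.exists_eq_add_of_le' hi
    rw [splice_add h, show j + q + 1 = j + 1 + q by omega, splice_add h,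
      show j + 1 + p = j + p + 1 by omega]
    exact hz _

theorem splice_splice {u w : ℕ → Fin N} {p q : ℕ} {z : ℕ → Fin N} (hz : ∀ i ≤ p, z i = u i)
    (h : u p = w q) : splice u p q (splice w q p z) = z := by
  funext i
  rcases le_or_gt i p with hi | hi
  · rw [splice_of_le hi, hz i hi]
  · obtain ⟨j, rfl⟩ := Nat.exists_eq_add_of_le' hi.le
    have hwz : w q = z p := by rw [hz p le_rfl, h]
    rw [splice_add (by rw [splice_of_le le_rfl, h]), splice_add hwz]

theorem continuous_splice (w : ℕ → Fin N) (q p : ℕ) : Continuous (splice w q p) := by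
  refine continuous_pi fun i => ?_
  by_cases hi : i ≤ q
  · simp only [splice, hi, if_true]
    exact continuous_const
  · simp only [splice, hi, if_false]
    exact continuous_apply _

open Classical in
/-- The map that exchanges the prefixes `u 0, …, u p` and `w 0, …, w q` and fixes the sequences that
have neither. -/
noncomputable def exchange (u w : ℕ → Fin N) (p q : ℕ) (z : ℕ → Fin N) : ℕ → Fin N :=
  if ∀ i ≤ p, z i = u i then splice w q p z
  else if ∀ i ≤ q, z i = w i then splice u p q z else z

theorem exchange_eq_left {u w : ℕ → Fin N} {p q : ℕ} {z : ℕ → Fin N} (hz : ∀ i ≤ p, z i = u i) :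
    exchange u w p q z = splice w q p z := if_pos hz

theorem exchange_eq_right {u w : ℕ → Fin N} {p q : ℕ} {z : ℕ → Fin N} (hz : ∀ i ≤ q, z i = w i)
    (hd : ∃ i, i ≤ p ∧ i ≤ q ∧ u i ≠ w i) : exchange u w p q z = splice u p q z := by
  obtain ⟨i, hip, hiq, hne⟩ := hd
  rw [exchange, if_neg fun h => hne ((h i hip).symm.trans (hz i hiq)), if_pos hz]

theorem exchange_eq_self {u w : ℕ → Fin N} {p q : ℕ} {z : ℕ → Fin N}
    (hu : ¬ ∀ i ≤ p, z i = u i) (hw : ¬ ∀ i ≤ q, z i = w i) : exchange u w p q z = z := by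
  rw [exchange, if_neg hu, if_neg hw]

theorem exchange_involutive {u w : ℕ → Fin N} {p q : ℕ} (h : u p = w q)
    (hd : ∃ i, i ≤ p ∧ i ≤ q ∧ u i ≠ w i) (z : ℕ → Fin N) :
    exchange u w p q (exchange u w p q z) = z := by
  by_cases hu : ∀ i ≤ p, z i = u i
  · rw [exchange_eq_left hu, exchange_eq_right (fun i hi => splice_of_le hi) hd,
      splice_splice hu h]
  · by_cases hw : ∀ i ≤ q, z i = w i
    · rw [exchange_eq_right hw hd, exchange_eq_left (fun i hi => splice_of_le hi),
        splice_splice hw h.symm]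
    · rw [exchange_eq_self hu hw, exchange_eq_self hu hw]

theorem exchange_mem {u w : ℕ → Fin N} {p q : ℕ} (hu : IsWord A u p) (hw : IsWord A w q)
    (h : u p = w q) {z : ℕ → Fin N} (hz : z ∈ shiftSpace A) :
    exchange u w p q z ∈ shiftSpace A := by
  rw [exchange]
  split_ifs with h₁ h₂
  · exact splice_mem hw hz (by rw [h₁ p le_rfl, h])
  · exact splice_mem hu hz (by rw [h₂ q le_rfl, h])
  · exact hz

theorem continuous_exchange (A : Matrix (Fin N) (Fin N) ℤ) (u w : ℕ → Fin N) (p q : ℕ) :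
    Continuous fun z : shiftSpace A => exchange u w p q z.1 := by
  classical
  unfold exchange
  refine Continuous.if (fun z hz => ?_) ((continuous_splice w q p).comp continuous_subtype_val)
    (Continuous.if (fun z hz => ?_) ((continuous_splice u p q).comp continuous_subtype_val)
      continuous_subtype_val)
  · rw [(isClopen_cylinder u p).frontier_eq] at hz
    exact hz.elim
  · rw [(isClopen_cylinder w q).frontier_eq] at hz
    exact hz.elim

/-- The prefix exchange as a homeomorphism of the shift space, for two admissible words that end in
the same letter and none of which is a prefix of the other. -/
noncomputable def exchangeHomeomorph {u w : ℕ → Fin N} {p q : ℕ} (hu : IsWord A u p)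
    (hw : IsWord A w q) (h : u p = w q) (hd : ∃ i, i ≤ p ∧ i ≤ q ∧ u i ≠ w i) :
    shiftSpace A ≃ₜ shiftSpace A where
  toFun z := ⟨exchange u w p q z.1, exchange_mem hu hw h z.2⟩
  invFun z := ⟨exchange u w p q z.1, exchange_mem hu hw h z.2⟩
  left_inv z := Subtype.ext (exchange_involutive h hd z.1)
  right_inv z := Subtype.ext (exchange_involutive h hd z.1)
  continuous_toFun := (continuous_exchange A u w p q).subtype_mk _
  continuous_invFun := (continuous_exchange A u w p q).subtype_mk _

theorem exchangeHomeomorph_mem {u w : ℕ → Fin N} {p q : ℕ} (hu : IsWord A u p)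
    (hw : IsWord A w q) (h : u p = w q) (hd : ∃ i, i ≤ p ∧ i ≤ q ∧ u i ≠ w i) :
    exchangeHomeomorph hu hw h hd ∈ continuousFullGroup A := by
  classical
  have hcont : ∀ a b : ℕ, Continuous fun z : shiftSpace A =>
      if ∀ i ≤ p, z.1 i = u i then a else if ∀ i ≤ q, z.1 i = w i then b else 0 := by
    intro a b
    refine Continuous.if (fun z hz => ?_) continuous_const
      (Continuous.if (fun z hz => ?_) continuous_const continuous_const)
    · rw [(isClopen_cylinder u p).frontier_eq] at hz
      exact hz.elim
    · rw [(isClopen_cylinder w q).frontier_eq] at hz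
      exact hz.elim
  refine ⟨_, _, hcont q p, hcont p q, fun z => Subtype.ext (funext fun i => ?_)⟩
  rw [shiftMap_iterate_apply, shiftMap_iterate_apply]
  change exchange u w p q z.1 _ = _
  by_cases h₁ : ∀ i ≤ p, z.1 i = u i
  · rw [exchange_eq_left h₁, if_pos h₁, if_pos h₁, splice_add (by rw [h₁ p le_rfl, h])]
  · by_cases h₂ : ∀ i ≤ q, z.1 i = w i
    · rw [exchange_eq_right h₂ hd, if_neg h₁, if_neg h₁, if_pos h₂, if_pos h₂,
        splice_add (by rw [h₂ q le_rfl, h])]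
    · rw [exchange_eq_self h₁ h₂, if_neg h₁, if_neg h₁, if_neg h₂, if_neg h₂]

end Exchange

/-! ### The continuous full group has many involutions -/

section FullGroup

variable {N : ℕ} {A : Matrix (Fin N) (Fin N) ℤ}

instance continuousFullGroupAction (A : Matrix (Fin N) (Fin N) ℤ) :
    MulAction (continuousFullGroup A) (shiftSpace A) where
  smul τ x := τ.1 x
  one_smul _ := rfl
  mul_smul _ _ _ := rfl

instance (A : Matrix (Fin N) (Fin N) ℤ) :
    ContinuousConstSMul (continuousFullGroup A) (shiftSpace A) :=
  ⟨fun τ => τ.1.continuous⟩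

instance (A : Matrix (Fin N) (Fin N) ℤ) : FaithfulSMul (continuousFullGroup A) (shiftSpace A) :=
  ⟨fun h => Subtype.ext (Homeomorph.ext h)⟩

instance (A : Matrix (Fin N) (Fin N) ℤ) : CompactSpace (shiftSpace A) :=
  isCompact_iff_compactSpace.1 (isCompact_shiftSpace A)

theorem eq_of_eventually_periodic {a b : ℕ} (hab : a < b) {x z : ℕ → Fin N}
    (hx : ∀ i, x (i + a) = x (i + b)) (hz : ∀ i, z (i + a) = z (i + b))
    (h : ∀ i ≤ b, z i = x i) : z = x := by
  funext i
  induction i using Nat.strong_induction_on with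
  | _ i ih =>
    rcases le_or_gt i b with hi | hi
    · exact h i hi
    · obtain ⟨j, rfl⟩ := Nat.exists_eq_add_of_le' hi.le
      rw [← hx, ← hz]
      exact ih _ (by omega)

/-- Let the involution `t` fix `x`, with orbit cocycles `K, L` near `x`. If `K = L`, then `t` fixes
all points near `x`. If `K ≠ L`, then every `z` near `x` satisfies `z (i + 2 K) = z (i + 2 L)` for
all `i`, so that `x` is isolated. -/
theorem isOpen_fixed_of_mul_self_eq_one {t : continuousFullGroup A} (ht : t * t = 1) :
    IsOpen {x : shiftSpace A | t • x = x} := by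
  obtain ⟨k, l, hk, hl, hkl⟩ := t.2
  have htt : ∀ z : shiftSpace A, t • t • z = z := fun z => by rw [← mul_smul, ht, one_smul]
  rw [isOpen_iff_mem_nhds]
  intro x hx
  have hx' : t • x = x := hx
  set K := k x with hK
  set L := l x with hL
  set V := k ⁻¹' {K} ∩ l ⁻¹' {L} ∩ {z : shiftSpace A | ∀ i ≤ 2 * K + 2 * L, z.1 i = x.1 i} with hV
  have hVx : V ∈ nhds x := by
    refine IsOpen.mem_nhds ?_ ⟨⟨rfl, rfl⟩, fun _ _ => rfl⟩
    exact (((isOpen_discrete _).preimage hk).inter ((isOpen_discrete _).preimage hl)).inter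
      (isClopen_cylinder _ _).isOpen
  have hVt : (fun z : shiftSpace A => t • z) ⁻¹' V ∈ nhds x :=
    (continuous_const_smul t).continuousAt.preimage_mem_nhds (by rwa [hx'])
  have hcoc : ∀ z ∈ V, ∀ i, (t • z).1 (i + K) = z.1 (i + L) := by
    rintro z ⟨⟨hkz, hlz⟩, -⟩ i
    have h : k z = K ∧ l z = L := ⟨hkz, hlz⟩
    have := congrArg (fun y => y.1 i) (hkl z)
    rwa [h.1, h.2, shiftMap_iterate_apply, shiftMap_iterate_apply] at this
  have hper : ∀ z ∈ V, t • z ∈ V → ∀ i, z.1 (i + 2 * K) = z.1 (i + 2 * L) := by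
    intro z hz htz i
    have h₁ := hcoc z hz (i + L)
    have h₂ := hcoc (t • z) htz (i + K)
    rw [htt] at h₂
    rw [show i + 2 * K = i + K + K by omega, h₂, show i + K + L = i + L + K by omega, h₁,
      show i + L + L = i + 2 * L by omega]
  have hxV : x ∈ V := mem_of_mem_nhds hVx
  have hxper := hper x hxV (by rwa [hx'])
  filter_upwards [hVx, hVt] with z hz htz
  have hzper := hper z hz htz
  rcases lt_trichotomy K L with hlt | heq | hlt
  · have : z = x := Subtype.ext (eq_of_eventually_periodic (by omega) hxper hzper
      fun i hi => hz.2 i (by omega))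
    rw [this, hx']
  · refine Subtype.ext (funext fun i => ?_)
    rcases le_or_gt i K with hi | hi
    · rw [htz.2 i (by omega), hz.2 i (by omega)]
    · obtain ⟨j, rfl⟩ := Nat.exists_eq_add_of_le' hi.le
      rw [hcoc z hz, heq]
  · have : z = x := Subtype.ext (eq_of_eventually_periodic (by omega) (fun i => (hxper i).symm)
      (fun i => (hzper i).symm) fun i hi => hz.2 i (by omega))
    rw [this, hx']

theorem hasLocalInvolutions_continuousFullGroup (h01 : ∀ i j, A i j = 0 ∨ A i j = 1)
    (hirr : A.IsIrreducible) (hI : ConditionI A) :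
    HasLocalInvolutions (continuousFullGroup A) (shiftSpace A) where
  exists_moving x U hU hx := by
    obtain ⟨n, hn⟩ := exists_cylinder_subset hU hx
    obtain ⟨w, q, p, hnp, hpq, hwx, hne, hw, hend⟩ := exists_word_leaving h01 hirr hI x n
    have hu : IsWord A x.1 p := fun i _ => x.2 i
    have hd : ∃ i, i ≤ p ∧ i ≤ q ∧ x.1 i ≠ w i := ⟨p, le_rfl, hpq, hne.symm⟩
    refine ⟨⟨_, exchangeHomeomorph_mem hu hw hend.symm hd⟩, ?_, fun hfix => ?_, fun y hy => ?_⟩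
    · exact Subtype.ext (Homeomorph.ext fun z => Subtype.ext (exchange_involutive hend.symm hd z.1))
    · have h : exchange x.1 w p q x.1 p = x.1 p := congrArg (fun y => y.1 p) hfix
      rw [exchange_eq_left fun _ _ => rfl, splice_of_le hpq] at h
      exact hne h
    · refine Subtype.ext (exchange_eq_self (fun h => hy (hn y fun i hi => ?_))
        fun h => hy (hn y fun i hi => ?_))
      · exact h i (hi.trans hnp)
      · rw [h i (by omega), hwx i hi]
  isOpen_fixed _ ht := isOpen_fixed_of_mul_self_eq_one ht

end FullGroup

/-! ### Spatial isomorphisms -/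

section Spatial

variable {N M : ℕ} {A : Matrix (Fin N) (Fin N) ℤ} {B : Matrix (Fin M) (Fin M) ℤ}

/-- Conjugation by a homeomorphism that carries `Γ_A` onto `Γ_B`. -/
def SpatiallyIsomorphic.mulEquivOfImage (h : shiftSpace A ≃ₜ shiftSpace B)
    (hh : (fun γ : shiftSpace A ≃ₜ shiftSpace A => (h.symm.trans γ).trans h) ''
      (continuousFullGroup A : Set (shiftSpace A ≃ₜ shiftSpace A)) =
      (continuousFullGroup B : Set (shiftSpace B ≃ₜ shiftSpace B))) :
    continuousFullGroup A ≃* continuousFullGroup B where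
  toFun γ := ⟨(h.symm.trans γ.1).trans h, hh.subset ⟨γ.1, γ.2, rfl⟩⟩
  invFun δ := ⟨(h.trans δ.1).trans h.symm, by
    obtain ⟨γ, hγ, hδ⟩ := hh.superset δ.2
    have : (h.trans δ.1).trans h.symm = γ := by
      rw [← hδ]
      ext x : 1
      simp
    rw [this]
    exact hγ⟩
  left_inv γ := Subtype.ext (Homeomorph.ext fun x => by simp)
  right_inv δ := Subtype.ext (Homeomorph.ext fun x => by simp)
  map_mul' γ δ := Subtype.ext (Homeomorph.ext fun x => by simp [Homeomorph.mul_apply])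

theorem IsSpatial.spatiallyIsomorphic {α : continuousFullGroup A ≃* continuousFullGroup B}
    (hα : IsSpatial α) : SpatiallyIsomorphic A B := by
  obtain ⟨h, hh⟩ := hα
  refine ⟨h, Set.Subset.antisymm ?_ fun δ hδ => ?_⟩
  · rintro _ ⟨γ, hγ, rfl⟩
    have h' : ((h.symm.trans γ).trans h) ∈ continuousFullGroup B := by
      rw [← hh ⟨γ, hγ⟩]
      exact (α ⟨γ, hγ⟩).2
    exact h'
  · refine ⟨(α.symm ⟨δ, hδ⟩).1, (α.symm ⟨δ, hδ⟩).2, ?_⟩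
    exact (hh _).symm.trans (congrArg Subtype.val (α.apply_symm_apply ⟨δ, hδ⟩))

end Spatial

theorem theorem1p1 {N M : ℕ} (A : Matrix (Fin N) (Fin N) ℤ) (B : Matrix (Fin M) (Fin M) ℤ)
    (hA : ∀ i j, A i j = 0 ∨ A i j = 1) (hB : ∀ i j, B i j = 0 ∨ B i j = 1)
    (hAirr : A.IsIrreducible) (hBirr : B.IsIrreducible)
    (hAI : ConditionI A) (hBI : ConditionI B) :
    (∀ α : continuousFullGroup A ≃* continuousFullGroup B, IsSpatial α) ∧
      (Nonempty (continuousFullGroup A ≃* continuousFullGroup B) ↔ SpatiallyIsomorphic A B) := by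
  have hspatial : ∀ α : continuousFullGroup A ≃* continuousFullGroup B, IsSpatial α := by
    intro α
    obtain ⟨h, hh⟩ := (hasLocalInvolutions_continuousFullGroup hA hAirr hAI).exists_homeomorph
      (hasLocalInvolutions_continuousFullGroup hB hBirr hBI) α
    refine ⟨h, fun γ => Homeomorph.ext fun y => ?_⟩
    have := hh γ (h.symm y)
    rw [h.apply_symm_apply] at this
    exact this.symm
  exact ⟨hspatial, fun ⟨α⟩ => (hspatial α).spatiallyIsomorphic,
    fun ⟨h, hh⟩ => ⟨SpatiallyIsomorphic.mulEquivOfImage h hh⟩⟩
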